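/- Fix a deletion probability $d\in[0,1]$. For $n\ge 1$ and a random vector $X^n=(X_1,\dots,X_n)\in\{0,1\}^n$, let $Y(X^n)$ be the binary string obtained from $X^n$ by deleting each bit independently (of the other deletions and of $X^n$) with probability $d$ and keeping the remaining bits in order. Let $I(\cdot\,;\cdot)$ denote mutual information in bits (logarithms to base $2$), and let $$C_n=\frac1n\max_{p_{X^n}} I(X^n;Y(X^n)),$$ the maximum being over all probability distributions $p_{X^n}$ of $X^n$ on $\{0,1\}^n$ (this maximum is attained). Then: (i) for every stationary ergodic process $\mathbb X=\{X_i\}_{i\in\mathbb Z}$ with values in $\{0,1\}$, the limit $$I(\mathbb X)=\lim_{n\to\infty}\frac1n I(X^n;Y(X^n)),\qquad X^n=(X_1,\dots,X_n),$$ exists (and is finite); (ii) the limit $C=\lim_{n\to\infty}C_n$ exists (and is finite), and $$C=\max_{\mathbb X\ \text{stationary ergodic}} I(\mathbb X),$$ that is, $I(\mathbb X)\le C$ for every stationary ergodic binary process $\mathbb X$, with equality for at least one of them. -/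

import Mathlib

namespace DeletionChannel

/-- The distribution of a random variable `X` defined on a finite probability space with
point masses `P`: the probability of the event `X = a`. -/
noncomputable def pr {Ω α : Type*} [Fintype Ω] [DecidableEq α] (P : Ω → ℝ) (X : Ω → α) (a : α) :
    ℝ :=
  ∑ ω ∈ Finset.univ.filter (fun ω => X ω = a), P ω

/-- Shannon entropy, in bits, of a random variable `X` on a finite probability space with
point masses `P`. (`Real.negMulLog t = -t * Real.log t`, which is `0` at `t = 0`.) -/
noncomputable def entropy {Ω α : Type*} [Fintype Ω] [DecidableEq α] (P : Ω → ℝ) (X : Ω → α) : ℝ :=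
  ∑ a ∈ Finset.univ.image X, Real.negMulLog (pr P X a) / Real.log 2

/-- Mutual information `I(X; Y) = H(X) + H(Y) - H(X, Y)`, in bits, of two random variables on a
finite probability space with point masses `P`. -/
noncomputable def mutualInfo {Ω α β : Type*} [Fintype Ω] [DecidableEq α] [DecidableEq β]
    (P : Ω → ℝ) (X : Ω → α) (Y : Ω → β) : ℝ :=
  entropy P X + entropy P Y - entropy P (fun ω => (X ω, Y ω))

/-- The channel output on input `x` when exactly the bits at positions `i` with `e i = true` are
deleted: the list of the remaining bits, in order. -/
def output {n : ℕ} (x e : Fin n → Bool) : List Bool :=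
  ((List.finRange n).filter (fun i => !(e i))).map x

/-- The probability of the deletion pattern `e` when every bit is deleted independently with
probability `d`. -/
noncomputable def patternProb (d : ℝ) {n : ℕ} (e : Fin n → Bool) : ℝ :=
  ∏ i, if e i = true then d else 1 - d

/-- `I(X^n; Y(X^n))` in bits, where `X^n` has point masses `p` and `Y(X^n)` is the output of the
deletion channel with deletion probability `d`. The underlying finite probability space consists
of the pairs (input, deletion pattern), the two components being independent. -/
noncomputable def blockInfo (d : ℝ) (n : ℕ) (p : (Fin n → Bool) → ℝ) : ℝ :=
  mutualInfo (fun ω : (Fin n → Bool) × (Fin n → Bool) => p ω.1 * patternProb d ω.2)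
    (fun ω => ω.1) (fun ω => output ω.1 ω.2)

/-- `C_n`: the supremum of `I(X^n; Y(X^n)) / n` over all input distributions on `{0,1}^n`. -/
noncomputable def blockCapacity (d : ℝ) (n : ℕ) : ℝ :=
  sSup ((fun p => blockInfo d n p / n) '' stdSimplex ℝ (Fin n → Bool))

/-- The left shift on two-sided binary sequences. -/
def shift (x : ℤ → Bool) : ℤ → Bool := fun i => x (i + 1)

/-- `μ` is the law of a stationary ergodic binary process `(X_i)`, `i ∈ ℤ`: a probability measure
on sequence space that is invariant and ergodic under the shift. -/
def IsStationaryErgodic (μ : MeasureTheory.Measure (ℤ → Bool)) : Prop :=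
  MeasureTheory.IsProbabilityMeasure μ ∧ Ergodic shift μ

/-- The point masses of `X^n = (X_1, …, X_n)` when the process `(X_i)` has law `μ`. -/
noncomputable def prefixLaw (μ : MeasureTheory.Measure (ℤ → Bool)) (n : ℕ) (x : Fin n → Bool) : ℝ :=
  μ.real {ω | ∀ i : Fin n, ω ((i : ℤ) + 1) = x i}

/-- `I(𝕏) = r` for a process `𝕏` with law `μ`: the limit of `I(X^n; Y(X^n)) / n` exists and
equals `r`. -/
def HasInfoRate (d : ℝ) (μ : MeasureTheory.Measure (ℤ → Bool)) (r : ℝ) : Prop :=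
  Filter.Tendsto (fun n : ℕ => blockInfo d n (prefixLaw μ n) / n) Filter.atTop (nhds r)

end DeletionChannel

namespace DeletionChannel

open Finset Real

/-! Given the input, the output on a concatenated word is the concatenation of independent outputs
on its two parts. Forgetting where the output splits only loses information, and two independent
channels carry at most the sum of their informations, so block information is subadditive
(`blockInfo_add_le`). Fekete's lemma then yields the rate of every stationary law and the limit of
`maxInfo d n / n`, each as the infimum of its quotients over `n ≥ 1`. No rate exceeds the capacity,
because `blockInfo` is at most `maxInfo`.

For attainment, extend an optimal law on words of length `N` to sequences and average its first `N`
shifts. Subadditivity over windows and concavity in the input law show that a block of length `k`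
then carries at least `k` times the capacity, up to `O(1/N)` (`le_blockInfo_shiftAverage`). A weak
limit point is stationary and, block information being continuous, optimal.

Ergodicity comes from convexity. Mixing two laws adds at most the entropy of the weights, which
vanishes per symbol, so the stationary components of an optimal mixture are optimal: the optimal
laws form a compact face of the stationary laws. An extreme point of that face is extreme among all
stationary laws, hence ergodic. -/

lemma sum_pr_mul {Ω α : Type*} [Fintype Ω] [DecidableEq α] (P : Ω → ℝ) (X : Ω → α)
    {s : Finset α} (hs : ∀ ω, X ω ∈ s) (g : α → ℝ) :
    ∑ a ∈ s, pr P X a * g a = ∑ ω, P ω * g (X ω) := by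
  rw [← Finset.sum_fiberwise_of_maps_to (g := X) (t := s) (fun ω _ => hs ω)]
  refine Finset.sum_congr rfl fun a _ => ?_
  rw [pr, Finset.sum_mul]
  refine Finset.sum_congr rfl fun ω hω => ?_
  rw [(Finset.mem_filter.1 hω).2]

lemma pr_eq_zero {Ω α : Type*} [Fintype Ω] [DecidableEq α] (P : Ω → ℝ) (X : Ω → α) {a : α}
    (h : ∀ ω, X ω ≠ a) : pr P X a = 0 := by
  rw [pr, Finset.filter_false_of_mem (fun ω _ => h ω), Finset.sum_empty]

lemma patternProb_nonneg {d : ℝ} (hd0 : 0 ≤ d) (hd1 : d ≤ 1) {n : ℕ} (e : Fin n → Bool) :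
    0 ≤ patternProb d e :=
  Finset.prod_nonneg fun i _ => by split_ifs <;> linarith

lemma sum_patternProb (d : ℝ) (n : ℕ) : ∑ e : Fin n → Bool, patternProb d e = 1 := by
  have := Finset.prod_univ_sum (fun _ : Fin n => (Finset.univ : Finset Bool))
    (fun _ b => if b = true then d else 1 - d)
  simp only [Fintype.piFinset_univ] at this
  simp only [patternProb]
  rw [← this]
  simp

/-! ### The channel as a transition kernel -/

/-- The set of all outputs on inputs of length `n`. -/
def outputs (n : ℕ) : Finset (List Bool) :=
  Finset.univ.image (fun ω : (Fin n → Bool) × (Fin n → Bool) => output ω.1 ω.2)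

lemma output_mem_outputs {n : ℕ} (x e : Fin n → Bool) : output x e ∈ outputs n :=
  Finset.mem_image.2 ⟨(x, e), Finset.mem_univ _, rfl⟩

/-- The transition probability of the channel from the input `x` to the output `y`. -/
noncomputable def transProb (d : ℝ) {n : ℕ} (x : Fin n → Bool) (y : List Bool) : ℝ :=
  pr (patternProb d) (output x) y

/-- The point masses of the output for the input distribution `p`. -/
noncomputable def outputLaw (d : ℝ) {n : ℕ} (p : (Fin n → Bool) → ℝ) (y : List Bool) : ℝ :=
  ∑ x, p x * transProb d x y

lemma transProb_nonneg {d : ℝ} (hd0 : 0 ≤ d) (hd1 : d ≤ 1) {n : ℕ} (x : Fin n → Bool)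
    (y : List Bool) : 0 ≤ transProb d x y :=
  Finset.sum_nonneg fun e _ => patternProb_nonneg hd0 hd1 e

lemma sum_transProb_mul (d : ℝ) {n : ℕ} (x : Fin n → Bool) (g : List Bool → ℝ) :
    ∑ y ∈ outputs n, transProb d x y * g y = ∑ e, patternProb d e * g (output x e) :=
  sum_pr_mul _ _ (output_mem_outputs x) g

lemma sum_transProb (d : ℝ) {n : ℕ} (x : Fin n → Bool) :
    ∑ y ∈ outputs n, transProb d x y = 1 := by
  simpa [sum_patternProb] using sum_transProb_mul d x (fun _ => 1)

lemma sum_outputLaw (d : ℝ) {n : ℕ} (p : (Fin n → Bool) → ℝ) :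
    ∑ y ∈ outputs n, outputLaw d p y = ∑ x, p x := by
  simp only [outputLaw]
  rw [Finset.sum_comm]
  simp_rw [← Finset.mul_sum, sum_transProb, mul_one]

lemma outputLaw_nonneg {d : ℝ} (hd0 : 0 ≤ d) (hd1 : d ≤ 1) {n : ℕ} {p : (Fin n → Bool) → ℝ}
    (hp : ∀ x, 0 ≤ p x) (y : List Bool) : 0 ≤ outputLaw d p y :=
  Finset.sum_nonneg fun x _ => mul_nonneg (hp x) (transProb_nonneg hd0 hd1 x y)

lemma pr_input (d : ℝ) {n : ℕ} (p : (Fin n → Bool) → ℝ) (x : Fin n → Bool) :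
    pr (fun ω : (Fin n → Bool) × (Fin n → Bool) => p ω.1 * patternProb d ω.2)
      (fun ω => ω.1) x = p x := by
  rw [pr, Finset.sum_filter, Fintype.sum_prod_type, Finset.sum_eq_single x]
  · simp [← Finset.mul_sum, sum_patternProb]
  · intro b _ hb
    simp [hb]
  · simp

lemma pr_input_output (d : ℝ) {n : ℕ} (p : (Fin n → Bool) → ℝ) (x : Fin n → Bool)
    (y : List Bool) :
    pr (fun ω : (Fin n → Bool) × (Fin n → Bool) => p ω.1 * patternProb d ω.2)
      (fun ω => (ω.1, output ω.1 ω.2)) (x, y) = p x * transProb d x y := by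
  rw [pr, Finset.sum_filter, Fintype.sum_prod_type, Finset.sum_eq_single x]
  · simp [transProb, pr, Finset.mul_sum, Finset.sum_filter]
  · intro b _ hb
    simp [hb]
  · simp

lemma pr_output (d : ℝ) {n : ℕ} (p : (Fin n → Bool) → ℝ) (y : List Bool) :
    pr (fun ω : (Fin n → Bool) × (Fin n → Bool) => p ω.1 * patternProb d ω.2)
      (fun ω => output ω.1 ω.2) y = outputLaw d p y := by
  rw [pr, Finset.sum_filter, Fintype.sum_prod_type, outputLaw]
  refine Finset.sum_congr rfl fun x _ => ?_
  simp [transProb, pr, Finset.mul_sum, Finset.sum_filter]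

/-- Mutual information as output entropy minus conditional output entropy. -/
lemma blockInfo_eq (d : ℝ) (n : ℕ) (p : (Fin n → Bool) → ℝ) :
    blockInfo d n p = (∑ y ∈ outputs n, negMulLog (outputLaw d p y)
      - ∑ x, p x * ∑ y ∈ outputs n, negMulLog (transProb d x y)) / Real.log 2 := by
  have h1 : entropy (fun ω : (Fin n → Bool) × (Fin n → Bool) => p ω.1 * patternProb d ω.2)
      (fun ω => ω.1) = (∑ x, negMulLog (p x)) / Real.log 2 := by
    rw [entropy, Finset.sum_div]
    rw [Finset.image_univ_of_surjective Prod.fst_surjective]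
    simp_rw [pr_input]
  have h2 : entropy (fun ω : (Fin n → Bool) × (Fin n → Bool) => p ω.1 * patternProb d ω.2)
      (fun ω => output ω.1 ω.2)
        = (∑ y ∈ outputs n, negMulLog (outputLaw d p y)) / Real.log 2 := by
    rw [entropy, Finset.sum_div]
    simp_rw [pr_output]
    rfl
  have h3 : entropy (fun ω : (Fin n → Bool) × (Fin n → Bool) => p ω.1 * patternProb d ω.2)
      (fun ω => (ω.1, output ω.1 ω.2))
        = (∑ x, (negMulLog (p x) + p x * ∑ y ∈ outputs n, negMulLog (transProb d x y)))
          / Real.log 2 := by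
    rw [entropy, Finset.sum_div]
    rw [Finset.sum_subset (s₂ := Finset.univ ×ˢ outputs n)]
    · rw [Finset.sum_product]
      refine Finset.sum_congr rfl fun x _ => ?_
      rw [← Finset.sum_div]
      congr 1
      simp_rw [pr_input_output, negMulLog_mul]
      rw [Finset.sum_add_distrib, ← Finset.sum_mul, sum_transProb, one_mul, Finset.mul_sum]
    · intro a ha
      obtain ⟨ω, -, rfl⟩ := Finset.mem_image.1 ha
      simp [output_mem_outputs]
    · intro a _ ha
      rw [pr_eq_zero, negMulLog_zero, zero_div]
      intro ω hω
      exact ha (Finset.mem_image.2 ⟨ω, Finset.mem_univ _, hω⟩)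
  rw [blockInfo, mutualInfo, h1, h2, h3, Finset.sum_add_distrib]
  ring

lemma continuous_blockInfo (d : ℝ) (n : ℕ) : Continuous (blockInfo d n) := by
  have : blockInfo d n = fun p => (∑ y ∈ outputs n, negMulLog (outputLaw d p y)
      - ∑ x, p x * ∑ y ∈ outputs n, negMulLog (transProb d x y)) / Real.log 2 :=
    funext (blockInfo_eq d n)
  rw [this]
  refine Continuous.div_const (Continuous.sub ?_ ?_) _
  · refine continuous_finsetSum _ fun y _ => continuous_negMulLog.comp ?_
    unfold outputLaw
    fun_prop
  · fun_prop

/-! ### Concavity and mixing in the input law -/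

lemma outputLaw_add (d : ℝ) {n : ℕ} (p q : (Fin n → Bool) → ℝ) (y : List Bool) :
    outputLaw d (p + q) y = outputLaw d p y + outputLaw d q y := by
  simp [outputLaw, add_mul, Finset.sum_add_distrib]

lemma outputLaw_smul (d : ℝ) {n : ℕ} (a : ℝ) (p : (Fin n → Bool) → ℝ) (y : List Bool) :
    outputLaw d (a • p) y = a * outputLaw d p y := by
  simp [outputLaw, mul_assoc, Finset.mul_sum]

lemma concaveOn_blockInfo {d : ℝ} (hd0 : 0 ≤ d) (hd1 : d ≤ 1) (n : ℕ) :
    ConcaveOn ℝ (stdSimplex ℝ (Fin n → Bool)) (blockInfo d n) := by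
  refine ⟨convex_stdSimplex ℝ _, fun p hp q hq a b ha hb hab => ?_⟩
  rw [blockInfo_eq, blockInfo_eq, blockInfo_eq, smul_eq_mul, smul_eq_mul, mul_div_assoc',
    mul_div_assoc', ← add_div]
  refine div_le_div_of_nonneg_right ?_ (log_nonneg one_le_two)
  have h : ∀ y, a * negMulLog (outputLaw d p y) + b * negMulLog (outputLaw d q y)
      ≤ negMulLog (outputLaw d (a • p + b • q) y) := fun y => by
    rw [outputLaw_add, outputLaw_smul, outputLaw_smul]
    exact concaveOn_negMulLog.2 (outputLaw_nonneg hd0 hd1 hp.1 y)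
      (outputLaw_nonneg hd0 hd1 hq.1 y) ha hb hab
  have h' := Finset.sum_le_sum fun y (_ : y ∈ outputs n) => h y
  rw [Finset.sum_add_distrib, ← Finset.mul_sum, ← Finset.mul_sum] at h'
  simp only [Pi.add_apply, Pi.smul_apply, smul_eq_mul, add_mul, Finset.sum_add_distrib, mul_assoc,
    ← Finset.mul_sum]
  linarith

lemma negMulLog_add_le {s t : ℝ} (hs : 0 ≤ s) (ht : 0 ≤ t) :
    negMulLog (s + t) ≤ negMulLog s + negMulLog t := by
  rcases hs.eq_or_lt with rfl | hs'
  · simp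
  rcases ht.eq_or_lt with rfl | ht'
  · simp
  have h1 := mul_le_mul_of_nonneg_left (log_le_log hs' (le_add_of_nonneg_right ht)) hs
  have h2 := mul_le_mul_of_nonneg_left (log_le_log ht' (le_add_of_nonneg_left hs)) ht
  simp only [negMulLog]
  linarith

/-- Mixing two input distributions costs at most the entropy of the mixing weights. -/
lemma blockInfo_mix_le {d : ℝ} (hd0 : 0 ≤ d) (hd1 : d ≤ 1) {n : ℕ} {p q : (Fin n → Bool) → ℝ}
    (hp : p ∈ stdSimplex ℝ (Fin n → Bool)) (hq : q ∈ stdSimplex ℝ (Fin n → Bool))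
    {a b : ℝ} (ha : 0 ≤ a) (hb : 0 ≤ b) :
    blockInfo d n (a • p + b • q)
      ≤ a * blockInfo d n p + b * blockInfo d n q + (negMulLog a + negMulLog b) / Real.log 2 := by
  rw [blockInfo_eq, blockInfo_eq, blockInfo_eq, mul_div_assoc', mul_div_assoc', ← add_div,
    ← add_div]
  refine div_le_div_of_nonneg_right ?_ (log_nonneg one_le_two)
  -- By `negMulLog_mul`, scaling by a weight splits off its entropy; since the output masses sum to
  -- 1, exactly the entropy of the weights remains.
  have h : ∀ y, negMulLog (outputLaw d (a • p + b • q) y) ≤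
      (outputLaw d p y * negMulLog a + a * negMulLog (outputLaw d p y))
      + (outputLaw d q y * negMulLog b + b * negMulLog (outputLaw d q y)) := fun y => by
    rw [outputLaw_add, outputLaw_smul, outputLaw_smul, ← negMulLog_mul, ← negMulLog_mul]
    exact negMulLog_add_le (mul_nonneg ha (outputLaw_nonneg hd0 hd1 hp.1 y))
      (mul_nonneg hb (outputLaw_nonneg hd0 hd1 hq.1 y))
  have h' := Finset.sum_le_sum fun y (_ : y ∈ outputs n) => h y
  simp only [Finset.sum_add_distrib, ← Finset.mul_sum, ← Finset.sum_mul, sum_outputLaw, hp.2,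
    hq.2] at h'
  simp only [Pi.add_apply, Pi.smul_apply, smul_eq_mul, add_mul, Finset.sum_add_distrib, mul_assoc,
    ← Finset.mul_sum]
  linarith

/-- Jensen's inequality: the output law is the `p`-average of the transition laws, and `negMulLog`
is concave. -/
lemma blockInfo_nonneg {d : ℝ} (hd0 : 0 ≤ d) (hd1 : d ≤ 1) {n : ℕ} {p : (Fin n → Bool) → ℝ}
    (hp : p ∈ stdSimplex ℝ (Fin n → Bool)) : 0 ≤ blockInfo d n p := by
  rw [blockInfo_eq]
  refine div_nonneg ?_ (log_nonneg one_le_two)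
  rw [sub_nonneg]
  simp_rw [Finset.mul_sum]
  rw [Finset.sum_comm]
  refine Finset.sum_le_sum fun y _ => ?_
  exact concaveOn_negMulLog.le_map_sum (fun x _ => hp.1 x) hp.2
    (fun x _ => transProb_nonneg hd0 hd1 x y)

/-! ### Subadditivity over concatenated blocks -/

/-- Mutual information as the expectation of the information density. -/
lemma blockInfo_eq_sum_log (d : ℝ) (n : ℕ) (p : (Fin n → Bool) → ℝ) :
    blockInfo d n p = (∑ x, p x * ∑ y ∈ outputs n,
      transProb d x y * (Real.log (transProb d x y) - Real.log (outputLaw d p y)))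
        / Real.log 2 := by
  rw [blockInfo_eq]
  congr 1
  have h : ∑ y ∈ outputs n, negMulLog (outputLaw d p y)
      = - ∑ x, p x * ∑ y ∈ outputs n, transProb d x y * Real.log (outputLaw d p y) := by
    simp_rw [Finset.mul_sum]
    rw [Finset.sum_comm, ← Finset.sum_neg_distrib]
    refine Finset.sum_congr rfl fun y _ => ?_
    rw [negMulLog, outputLaw, ← neg_mul_eq_neg_mul, Finset.sum_mul]
    simp_rw [mul_assoc]
  rw [h]
  simp only [negMulLog, mul_sub, Finset.sum_sub_distrib, neg_mul, Finset.sum_neg_distrib, mul_neg]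
  ring

lemma sum_append {M : Type*} [AddCommMonoid M] {n m : ℕ} (F : (Fin (n + m) → Bool) → M) :
    ∑ x, F x = ∑ x₁ : Fin n → Bool, ∑ x₂ : Fin m → Bool, F (Fin.append x₁ x₂) := by
  rw [← (Fin.appendEquiv n m).sum_comp, Fintype.sum_prod_type]
  rfl

lemma patternProb_append (d : ℝ) {n m : ℕ} (e₁ : Fin n → Bool) (e₂ : Fin m → Bool) :
    patternProb d (Fin.append e₁ e₂) = patternProb d e₁ * patternProb d e₂ := by
  simp [patternProb, Fin.prod_univ_add]

lemma output_append {n m : ℕ} (x₁ e₁ : Fin n → Bool) (x₂ e₂ : Fin m → Bool) :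
    output (Fin.append x₁ x₂) (Fin.append e₁ e₂) = output x₁ e₁ ++ output x₂ e₂ := by
  simp only [output]
  rw [show List.finRange (n + m) = (List.finRange n).map (Fin.castAdd m)
      ++ (List.finRange m).map (Fin.natAdd n) by
    simp only [← List.ofFn_id, List.ofFn_add, List.map_ofFn]
    rfl]
  simp [List.filter_map, Function.comp_def]

/-- The output on a concatenated input is the concatenation of independent outputs on its two
parts. -/
lemma sum_transProb_append_mul (d : ℝ) {n m : ℕ} (x₁ : Fin n → Bool) (x₂ : Fin m → Bool)
    (g : List Bool → ℝ) :
    ∑ y ∈ outputs (n + m), transProb d (Fin.append x₁ x₂) y * g y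
      = ∑ y₁ ∈ outputs n, ∑ y₂ ∈ outputs m,
          transProb d x₁ y₁ * transProb d x₂ y₂ * g (y₁ ++ y₂) := by
  rw [sum_transProb_mul, sum_append]
  simp_rw [mul_assoc, ← Finset.mul_sum, sum_transProb_mul, patternProb_append, output_append,
    mul_assoc, ← Finset.mul_sum]

/-- The law of the first `n` symbols under a law on words of length `n + m`. -/
noncomputable def leftMarginal {n m : ℕ} (p : (Fin (n + m) → Bool) → ℝ) (x₁ : Fin n → Bool) : ℝ :=
  ∑ x₂ : Fin m → Bool, p (Fin.append x₁ x₂)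

/-- The law of the last `m` symbols under a law on words of length `n + m`. -/
noncomputable def rightMarginal {n m : ℕ} (p : (Fin (n + m) → Bool) → ℝ) (x₂ : Fin m → Bool) : ℝ :=
  ∑ x₁ : Fin n → Bool, p (Fin.append x₁ x₂)

/-- Cutting the output as `y₁`, `y₂` is only one of the ways in which the two parts can produce `y₁
++ y₂`. -/
lemma transProb_mul_le {d : ℝ} (hd0 : 0 ≤ d) (hd1 : d ≤ 1) {n m : ℕ} (x₁ : Fin n → Bool)
    (x₂ : Fin m → Bool) {y₁ y₂ : List Bool} (h₁ : y₁ ∈ outputs n) (h₂ : y₂ ∈ outputs m) :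
    transProb d x₁ y₁ * transProb d x₂ y₂ ≤ transProb d (Fin.append x₁ x₂) (y₁ ++ y₂) := by
  have h := sum_transProb_append_mul d x₁ x₂ (fun y => if y = y₁ ++ y₂ then 1 else 0)
  have hnn : ∀ a b : List Bool, 0 ≤ transProb d x₁ a * transProb d x₂ b *
      (if a ++ b = y₁ ++ y₂ then 1 else 0) := fun a b => by
    have := mul_nonneg (transProb_nonneg hd0 hd1 x₁ a) (transProb_nonneg hd0 hd1 x₂ b)
    split_ifs <;> simp [this]
  calc transProb d x₁ y₁ * transProb d x₂ y₂
      = transProb d x₁ y₁ * transProb d x₂ y₂ * (if y₁ ++ y₂ = y₁ ++ y₂ then 1 else 0) := by simp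
    _ ≤ ∑ b ∈ outputs m, transProb d x₁ y₁ * transProb d x₂ b *
          (if y₁ ++ b = y₁ ++ y₂ then 1 else 0) :=
        Finset.single_le_sum (f := fun b => transProb d x₁ y₁ * transProb d x₂ b *
          (if y₁ ++ b = y₁ ++ y₂ then 1 else 0)) (fun b _ => hnn y₁ b) h₂
    _ ≤ ∑ a ∈ outputs n, ∑ b ∈ outputs m, transProb d x₁ a * transProb d x₂ b *
          (if a ++ b = y₁ ++ y₂ then 1 else 0) :=
        Finset.single_le_sum (f := fun a => ∑ b ∈ outputs m, transProb d x₁ a * transProb d x₂ b *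
          (if a ++ b = y₁ ++ y₂ then 1 else 0))
          (fun a _ => Finset.sum_nonneg fun b _ => hnn a b) h₁
    _ = ∑ y ∈ outputs (n + m), transProb d (Fin.append x₁ x₂) y *
          (if y = y₁ ++ y₂ then 1 else 0) := h.symm
    _ ≤ transProb d (Fin.append x₁ x₂) (y₁ ++ y₂) := by
        simp only [mul_ite, mul_one, mul_zero, Finset.sum_ite_eq']
        split_ifs
        · exact le_rfl
        · exact transProb_nonneg hd0 hd1 _ _

lemma le_outputLaw {d : ℝ} (hd0 : 0 ≤ d) (hd1 : d ≤ 1) {n : ℕ} {p : (Fin n → Bool) → ℝ}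
    (hp : ∀ x, 0 ≤ p x) (x : Fin n → Bool) (y : List Bool) :
    p x * transProb d x y ≤ outputLaw d p y :=
  Finset.single_le_sum (f := fun x => p x * transProb d x y)
    (fun x _ => mul_nonneg (hp x) (transProb_nonneg hd0 hd1 x y)) (Finset.mem_univ x)

/-- Gibbs' inequality for one term of the sums comparing the block information densities. -/
lemma mul_log_density_le {p w r w₁ w₂ r₁ r₂ : ℝ} (hp : 0 ≤ p) (hw₁ : 0 ≤ w₁) (hw₂ : 0 ≤ w₂)
    (hr₁ : 0 ≤ r₁) (hr₂ : 0 ≤ r₂) (hr : 0 ≤ r) (hw : w₁ * w₂ ≤ w) (hpr : p * w ≤ r)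
    (hpr₁ : p * w₁ ≤ r₁) (hpr₂ : p * w₂ ≤ r₂) :
    p * (w₁ * w₂ * ((log w - log r) - (log w₁ - log r₁) - (log w₂ - log r₂)))
      ≤ p * w * (r₁ * r₂ / r) - p * (w₁ * w₂) := by
  have hw0 : 0 ≤ w := (mul_nonneg hw₁ hw₂).trans hw
  -- If this mass vanishes, so does the left side. Otherwise the domination hypotheses make every
  -- argument of `log` positive, and `log t ≤ t - 1` applies to the combined density.
  by_cases h : p * (w₁ * w₂) = 0
  · rw [← mul_assoc, h, zero_mul, sub_zero]
    positivity
  · have hp' : 0 < p := lt_of_le_of_ne hp fun h0 => h (by simp [← h0])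
    have hw₁' : 0 < w₁ := lt_of_le_of_ne hw₁ fun h0 => h (by simp [← h0])
    have hw₂' : 0 < w₂ := lt_of_le_of_ne hw₂ fun h0 => h (by simp [← h0])
    have hw' : 0 < w := (mul_pos hw₁' hw₂').trans_le hw
    have hr' : 0 < r := (mul_pos hp' hw').trans_le hpr
    have hr₁' : 0 < r₁ := (mul_pos hp' hw₁').trans_le hpr₁
    have hr₂' : 0 < r₂ := (mul_pos hp' hw₂').trans_le hpr₂
    have hlog : (log w - log r) - (log w₁ - log r₁) - (log w₂ - log r₂)
        = log (w * (r₁ * r₂) / (r * (w₁ * w₂))) := by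
      rw [log_div (by positivity) (by positivity), log_mul (by positivity) (by positivity),
        log_mul (by positivity) (by positivity), log_mul (by positivity) (by positivity),
        log_mul (by positivity) (by positivity)]
      ring
    rw [hlog, ← mul_assoc]
    refine (mul_le_mul_of_nonneg_left (log_le_sub_one_of_pos (by positivity))
      (by positivity)).trans_eq ?_
    field_simp

/-- Subadditivity of the information over a concatenation of two blocks. -/
lemma blockInfo_add_le {d : ℝ} (hd0 : 0 ≤ d) (hd1 : d ≤ 1) {n m : ℕ}
    {p : (Fin (n + m) → Bool) → ℝ} (hp : p ∈ stdSimplex ℝ (Fin (n + m) → Bool)) :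
    blockInfo d (n + m) p ≤ blockInfo d n (leftMarginal p) + blockInfo d m (rightMarginal p) := by
  rw [blockInfo_eq_sum_log, blockInfo_eq_sum_log, blockInfo_eq_sum_log, ← add_div]
  refine div_le_div_of_nonneg_right ?_ (log_nonneg one_le_two)
  set r := outputLaw d p with hr
  set r₁ := outputLaw d (leftMarginal p) with hr₁
  set r₂ := outputLaw d (rightMarginal p) with hr₂
  have hL : ∀ x, 0 ≤ leftMarginal p x := fun x => Finset.sum_nonneg fun _ _ => hp.1 _
  have hR : ∀ x, 0 ≤ rightMarginal p x := fun x => Finset.sum_nonneg fun _ _ => hp.1 _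
  have hLs : ∑ x, leftMarginal p x = 1 := by rw [← hp.2, sum_append]; rfl
  have hRs : ∑ x, rightMarginal p x = 1 := by
    rw [← hp.2, sum_append, Finset.sum_comm]; rfl
  have hpL : ∀ x₁ x₂, p (Fin.append x₁ x₂) ≤ leftMarginal p x₁ := fun x₁ x₂ =>
    Finset.single_le_sum (f := fun x₂ => p (Fin.append x₁ x₂)) (fun _ _ => hp.1 _)
      (Finset.mem_univ x₂)
  have hpR : ∀ x₁ x₂, p (Fin.append x₁ x₂) ≤ rightMarginal p x₂ := fun x₁ x₂ =>
    Finset.single_le_sum (f := fun x₁ => p (Fin.append x₁ x₂)) (fun _ _ => hp.1 _)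
      (Finset.mem_univ x₁)
  -- All three informations become expectations over the same quadruples `(x₁, x₂, y₁, y₂)`, so that
  -- their densities can be compared termwise.
  have e0 : ∑ x, p x * ∑ y ∈ outputs (n + m), transProb d x y * (log (transProb d x y) - log (r y))
      = ∑ x₁ : Fin n → Bool, ∑ x₂ : Fin m → Bool, ∑ y₁ ∈ outputs n, ∑ y₂ ∈ outputs m,
        p (Fin.append x₁ x₂) * (transProb d x₁ y₁ * transProb d x₂ y₂ *
          (log (transProb d (Fin.append x₁ x₂) (y₁ ++ y₂)) - log (r (y₁ ++ y₂)))) := by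
    rw [sum_append]
    refine Finset.sum_congr rfl fun x₁ _ => Finset.sum_congr rfl fun x₂ _ => ?_
    rw [sum_transProb_append_mul d x₁ x₂
      (fun y => log (transProb d (Fin.append x₁ x₂) y) - log (r y))]
    simp_rw [Finset.mul_sum]
  have e1 : ∑ x, leftMarginal p x * ∑ y ∈ outputs n,
        transProb d x y * (log (transProb d x y) - log (r₁ y))
      = ∑ x₁ : Fin n → Bool, ∑ x₂ : Fin m → Bool, ∑ y₁ ∈ outputs n, ∑ y₂ ∈ outputs m,
        p (Fin.append x₁ x₂) * (transProb d x₁ y₁ * transProb d x₂ y₂ *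
          (log (transProb d x₁ y₁) - log (r₁ y₁))) := by
    refine Finset.sum_congr rfl fun x₁ _ => ?_
    rw [leftMarginal, Finset.sum_mul]
    refine Finset.sum_congr rfl fun x₂ _ => ?_
    rw [Finset.mul_sum]
    refine Finset.sum_congr rfl fun y₁ _ => ?_
    rw [← Finset.mul_sum, ← Finset.sum_mul, ← Finset.mul_sum, sum_transProb, mul_one]
  have e2 : ∑ x, rightMarginal p x * ∑ y ∈ outputs m,
        transProb d x y * (log (transProb d x y) - log (r₂ y))
      = ∑ x₁ : Fin n → Bool, ∑ x₂ : Fin m → Bool, ∑ y₁ ∈ outputs n, ∑ y₂ ∈ outputs m,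
        p (Fin.append x₁ x₂) * (transProb d x₁ y₁ * transProb d x₂ y₂ *
          (log (transProb d x₂ y₂) - log (r₂ y₂))) := by
    rw [Finset.sum_comm]
    refine Finset.sum_congr rfl fun x₂ _ => ?_
    rw [rightMarginal, Finset.sum_mul]
    refine Finset.sum_congr rfl fun x₁ _ => ?_
    rw [Finset.sum_comm, Finset.mul_sum]
    refine Finset.sum_congr rfl fun y₂ _ => ?_
    rw [← Finset.mul_sum, ← Finset.sum_mul, ← Finset.sum_mul, sum_transProb, one_mul]
  rw [e0, e1, e2, ← sub_nonpos, sub_add_eq_sub_sub]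
  simp_rw [← Finset.sum_sub_distrib, ← mul_sub]
  have hbound : ∀ x₁ x₂, ∀ y₁ ∈ outputs n, ∀ y₂ ∈ outputs m,
      p (Fin.append x₁ x₂) * (transProb d x₁ y₁ * transProb d x₂ y₂ *
          (log (transProb d (Fin.append x₁ x₂) (y₁ ++ y₂)) - log (r (y₁ ++ y₂))
            - (log (transProb d x₁ y₁) - log (r₁ y₁)) - (log (transProb d x₂ y₂) - log (r₂ y₂))))
      ≤ p (Fin.append x₁ x₂) * transProb d (Fin.append x₁ x₂) (y₁ ++ y₂)
          * (r₁ y₁ * r₂ y₂ / r (y₁ ++ y₂))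
        - p (Fin.append x₁ x₂) * (transProb d x₁ y₁ * transProb d x₂ y₂) :=
    fun x₁ x₂ y₁ h₁ y₂ h₂ => mul_log_density_le (hp.1 _) (transProb_nonneg hd0 hd1 _ _)
      (transProb_nonneg hd0 hd1 _ _) (outputLaw_nonneg hd0 hd1 hL _)
      (outputLaw_nonneg hd0 hd1 hR _) (outputLaw_nonneg hd0 hd1 hp.1 _)
      (transProb_mul_le hd0 hd1 x₁ x₂ h₁ h₂) (le_outputLaw hd0 hd1 hp.1 _ _)
      ((mul_le_mul_of_nonneg_right (hpL x₁ x₂) (transProb_nonneg hd0 hd1 _ _)).trans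
        (le_outputLaw hd0 hd1 hL _ _))
      ((mul_le_mul_of_nonneg_right (hpR x₁ x₂) (transProb_nonneg hd0 hd1 _ _)).trans
        (le_outputLaw hd0 hd1 hR _ _))
  refine (Finset.sum_le_sum fun x₁ _ => Finset.sum_le_sum fun x₂ _ => Finset.sum_le_sum
    fun y₁ h₁ => Finset.sum_le_sum fun y₂ h₂ => hbound x₁ x₂ y₁ h₁ y₂ h₂).trans ?_
  simp only [Finset.sum_sub_distrib]
  have hone : ∑ x₁ : Fin n → Bool, ∑ x₂ : Fin m → Bool, ∑ y₁ ∈ outputs n, ∑ y₂ ∈ outputs m,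
      p (Fin.append x₁ x₂) * (transProb d x₁ y₁ * transProb d x₂ y₂) = 1 := by
    simp_rw [← Finset.mul_sum, sum_transProb, mul_one, sum_transProb, mul_one]
    rw [← hp.2, sum_append]
  -- Summing over the input turns `p` times the kernel into `r`, which cancels the denominator and
  -- leaves the product law `r₁ r₂` of total mass 1. Where `r` vanishes the term is 0, hence only an
  -- inequality.
  have hle : ∑ x₁ : Fin n → Bool, ∑ x₂ : Fin m → Bool, ∑ y₁ ∈ outputs n, ∑ y₂ ∈ outputs m,
      p (Fin.append x₁ x₂) * transProb d (Fin.append x₁ x₂) (y₁ ++ y₂)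
          * (r₁ y₁ * r₂ y₂ / r (y₁ ++ y₂)) ≤ 1 := by
    rw [← sum_append (fun x => ∑ y₁ ∈ outputs n, ∑ y₂ ∈ outputs m,
      p x * transProb d x (y₁ ++ y₂) * (r₁ y₁ * r₂ y₂ / r (y₁ ++ y₂))), Finset.sum_comm]
    have h1 : ∑ y₁ ∈ outputs n, ∑ y₂ ∈ outputs m, r₁ y₁ * r₂ y₂ = 1 := by
      rw [← Finset.sum_mul_sum, sum_outputLaw, sum_outputLaw, hLs, hRs, one_mul]
    rw [← h1]
    refine Finset.sum_le_sum fun y₁ _ => ?_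
    rw [Finset.sum_comm]
    refine Finset.sum_le_sum fun y₂ _ => ?_
    rw [← Finset.sum_mul]
    change r (y₁ ++ y₂) * (r₁ y₁ * r₂ y₂ / r (y₁ ++ y₂)) ≤ _
    have hnn : 0 ≤ r₁ y₁ * r₂ y₂ :=
      mul_nonneg (outputLaw_nonneg hd0 hd1 hL _) (outputLaw_nonneg hd0 hd1 hR _)
    by_cases h0 : r (y₁ ++ y₂) = 0
    · rwa [h0, zero_mul]
    · rw [mul_div_cancel₀ _ h0]
  linarith

end DeletionChannel

namespace DeletionChannel

open Finset Real MeasureTheory Filter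
open scoped Topology

/-! ### Shift space, prefix laws and information rates -/

lemma continuous_shift : Continuous shift :=
  continuous_pi fun i => continuous_apply (i + 1)

lemma measurable_shift : Measurable shift :=
  measurable_pi_lambda _ fun i => measurable_pi_apply (i + 1)

lemma shift_iterate_apply (n : ℕ) (ω : ℤ → Bool) (i : ℤ) : shift^[n] ω i = ω (i + n) := by
  induction n generalizing ω with
  | zero => simp
  | succ n ih =>
    rw [Function.iterate_succ_apply, ih, shift]
    push_cast
    ring_nf

/-- The set of sequences whose first symbols are given by the word `x`. -/
def cylinder {n : ℕ} (x : Fin n → Bool) : Set (ℤ → Bool) :=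
  {ω | ∀ i : Fin n, ω ((i : ℤ) + 1) = x i}

lemma prefixLaw_eq (μ : Measure (ℤ → Bool)) {n : ℕ} (x : Fin n → Bool) :
    prefixLaw μ n x = μ.real (cylinder x) := rfl

lemma isClopen_cylinder {n : ℕ} (x : Fin n → Bool) : IsClopen (cylinder x) := by
  have : cylinder x = ⋂ i : Fin n, (fun ω : ℤ → Bool => ω ((i : ℤ) + 1)) ⁻¹' {x i} := by
    ext ω; simp [cylinder]
  rw [this]
  exact isClopen_iInter_of_finite fun i => (isClopen_discrete _).preimage (continuous_apply _)

lemma measurableSet_cylinder {n : ℕ} (x : Fin n → Bool) : MeasurableSet (cylinder x) :=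
  (isClopen_cylinder x).isClosed.measurableSet

lemma disjoint_cylinder {n : ℕ} {x y : Fin n → Bool} (h : x ≠ y) :
    Disjoint (cylinder x) (cylinder y) :=
  Set.disjoint_left.2 fun _ hx hy => h (funext fun i => (hx i).symm.trans (hy i))

lemma mem_cylinder_append {n m : ℕ} {x₁ : Fin n → Bool} {x₂ : Fin m → Bool} {ω : ℤ → Bool} :
    ω ∈ cylinder (Fin.append x₁ x₂) ↔ ω ∈ cylinder x₁ ∧ shift^[n] ω ∈ cylinder x₂ := by
  simp only [cylinder, Set.mem_ofPred_eq, Fin.forall_fin_add, Fin.append_left, Fin.append_right,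
    shift_iterate_apply, Fin.val_castAdd, Fin.val_natAdd]
  refine and_congr Iff.rfl (forall_congr' fun i => ?_)
  rw [show ((n + (i : ℕ) : ℕ) : ℤ) + 1 = (i : ℤ) + 1 + n by push_cast; ring]

/-- Cylinders over words of length `n` partition the space. Taking for `g` an iterate of `shift`
sums out a suffix; taking the identity sums out a prefix. -/
lemma sum_measureReal_inter_cylinder (μ : Measure (ℤ → Bool)) [IsFiniteMeasure μ] (n : ℕ)
    {A : Set (ℤ → Bool)} (hA : MeasurableSet A) {g : (ℤ → Bool) → (ℤ → Bool)} (hg : Measurable g) :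
    ∑ x : Fin n → Bool, μ.real (A ∩ g ⁻¹' cylinder x) = μ.real A := by
  rw [← measureReal_biUnion_finset]
  · congr 1
    ext ω
    simp only [Finset.mem_univ, Set.iUnion_true, Set.mem_iUnion, Set.mem_inter_iff,
      Set.mem_preimage, exists_and_left, and_iff_left_iff_imp]
    exact fun _ => ⟨fun i => g ω ((i : ℤ) + 1), fun i => rfl⟩
  · intro x _ y _ hxy
    exact ((disjoint_cylinder hxy).preimage g).mono Set.inter_subset_right Set.inter_subset_right
  · exact fun x _ => hA.inter (hg (measurableSet_cylinder x))

lemma prefixLaw_mem_stdSimplex (μ : Measure (ℤ → Bool)) [IsProbabilityMeasure μ] (n : ℕ) :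
    prefixLaw μ n ∈ stdSimplex ℝ (Fin n → Bool) := by
  refine ⟨fun x => measureReal_nonneg, ?_⟩
  have := sum_measureReal_inter_cylinder μ n MeasurableSet.univ measurable_id
  simpa [prefixLaw_eq] using this

lemma leftMarginal_prefixLaw (μ : Measure (ℤ → Bool)) [IsFiniteMeasure μ] (n m : ℕ) :
    leftMarginal (prefixLaw μ (n + m)) = prefixLaw μ n := by
  ext x₁
  rw [prefixLaw_eq, ← sum_measureReal_inter_cylinder μ m (measurableSet_cylinder x₁)
    (measurable_shift.iterate n)]
  refine Finset.sum_congr rfl fun x₂ _ => ?_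
  rw [prefixLaw_eq]
  congr 1
  ext ω
  exact mem_cylinder_append

lemma rightMarginal_prefixLaw (μ : Measure (ℤ → Bool)) [IsFiniteMeasure μ] (n m : ℕ) :
    rightMarginal (prefixLaw μ (n + m)) = prefixLaw (μ.map shift^[n]) m := by
  ext x₂
  have hs := measurable_shift.iterate n
  rw [prefixLaw_eq, map_measureReal_apply hs (measurableSet_cylinder x₂),
    ← sum_measureReal_inter_cylinder μ n (hs (measurableSet_cylinder x₂)) measurable_id]
  refine Finset.sum_congr rfl fun x₁ _ => ?_
  rw [prefixLaw_eq]
  congr 1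
  ext ω
  exact mem_cylinder_append.trans and_comm

lemma blockInfo_prefixLaw_add_le {d : ℝ} (hd0 : 0 ≤ d) (hd1 : d ≤ 1) (μ : Measure (ℤ → Bool))
    [IsProbabilityMeasure μ] (n m : ℕ) :
    blockInfo d (n + m) (prefixLaw μ (n + m))
      ≤ blockInfo d n (prefixLaw μ n) + blockInfo d m (prefixLaw (μ.map shift^[n]) m) := by
  rw [← rightMarginal_prefixLaw, ← leftMarginal_prefixLaw μ n m]
  exact blockInfo_add_le hd0 hd1 (prefixLaw_mem_stdSimplex μ (n + m))

lemma subadditive_blockInfo {d : ℝ} (hd0 : 0 ≤ d) (hd1 : d ≤ 1) {μ : Measure (ℤ → Bool)}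
    [IsProbabilityMeasure μ] (hμ : MeasurePreserving shift μ μ) :
    Subadditive fun n => blockInfo d n (prefixLaw μ n) := fun n m => by
  simpa only [(hμ.iterate n).map_eq] using blockInfo_prefixLaw_add_le hd0 hd1 μ n m

lemma bddBelow_blockInfo_div {d : ℝ} (hd0 : 0 ≤ d) (hd1 : d ≤ 1) (μ : Measure (ℤ → Bool))
    [IsProbabilityMeasure μ] :
    BddBelow (Set.range fun n : ℕ => blockInfo d n (prefixLaw μ n) / n) :=
  ⟨0, by
    rintro _ ⟨n, rfl⟩
    exact div_nonneg (blockInfo_nonneg hd0 hd1 (prefixLaw_mem_stdSimplex μ n)) n.cast_nonneg⟩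

/-- The information rate of a stationary process exists. -/
lemma hasInfoRate_lim {d : ℝ} (hd0 : 0 ≤ d) (hd1 : d ≤ 1) {μ : Measure (ℤ → Bool)}
    [IsProbabilityMeasure μ] (hμ : MeasurePreserving shift μ μ) :
    HasInfoRate d μ (subadditive_blockInfo hd0 hd1 hμ).lim :=
  (subadditive_blockInfo hd0 hd1 hμ).tendsto_lim (bddBelow_blockInfo_div hd0 hd1 μ)

/-! ### Capacity as a Fekete limit -/

/-- The maximum of the information over all laws on words of length `n`. -/
noncomputable def maxInfo (d : ℝ) (n : ℕ) : ℝ :=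
  sSup (blockInfo d n '' stdSimplex ℝ (Fin n → Bool))

lemma isGreatest_maxInfo (d : ℝ) (n : ℕ) :
    IsGreatest (blockInfo d n '' stdSimplex ℝ (Fin n → Bool)) (maxInfo d n) :=
  ((isCompact_stdSimplex ℝ (Fin n → Bool)).image (continuous_blockInfo d n)).isGreatest_sSup
    (Set.Nonempty.image _ ⟨_, single_mem_stdSimplex ℝ (fun _ => false)⟩)

lemma blockInfo_le_maxInfo (d : ℝ) {n : ℕ} {p : (Fin n → Bool) → ℝ}
    (hp : p ∈ stdSimplex ℝ (Fin n → Bool)) : blockInfo d n p ≤ maxInfo d n :=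
  (isGreatest_maxInfo d n).2 ⟨p, hp, rfl⟩

lemma maxInfo_nonneg {d : ℝ} (hd0 : 0 ≤ d) (hd1 : d ≤ 1) (n : ℕ) : 0 ≤ maxInfo d n := by
  obtain ⟨p, hp, h⟩ := (isGreatest_maxInfo d n).1
  exact h ▸ blockInfo_nonneg hd0 hd1 hp

lemma isGreatest_maxInfo_div (d : ℝ) (n : ℕ) :
    IsGreatest ((fun p => blockInfo d n p / n) '' stdSimplex ℝ (Fin n → Bool))
      (maxInfo d n / n) := by
  obtain ⟨p, hp, h⟩ := (isGreatest_maxInfo d n).1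
  refine ⟨⟨p, hp, by rw [← h]⟩, ?_⟩
  rintro _ ⟨q, hq, rfl⟩
  exact div_le_div_of_nonneg_right (blockInfo_le_maxInfo d hq) n.cast_nonneg

lemma blockCapacity_eq (d : ℝ) (n : ℕ) : blockCapacity d n = maxInfo d n / n :=
  (isGreatest_maxInfo_div d n).csSup_eq

lemma subadditive_maxInfo {d : ℝ} (hd0 : 0 ≤ d) (hd1 : d ≤ 1) : Subadditive (maxInfo d) := by
  intro n m
  obtain ⟨p, hp, h⟩ := (isGreatest_maxInfo d (n + m)).1
  rw [← h]
  refine (blockInfo_add_le hd0 hd1 hp).trans (add_le_add (blockInfo_le_maxInfo d ?_)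
    (blockInfo_le_maxInfo d ?_))
  · exact ⟨fun x => Finset.sum_nonneg fun _ _ => hp.1 _, by rw [← hp.2, sum_append]; rfl⟩
  · exact ⟨fun x => Finset.sum_nonneg fun _ _ => hp.1 _, by
      rw [← hp.2, sum_append, Finset.sum_comm]; rfl⟩

lemma bddBelow_maxInfo_div {d : ℝ} (hd0 : 0 ≤ d) (hd1 : d ≤ 1) :
    BddBelow (Set.range fun n : ℕ => maxInfo d n / n) :=
  ⟨0, by
    rintro _ ⟨n, rfl⟩
    exact div_nonneg (maxInfo_nonneg hd0 hd1 n) n.cast_nonneg⟩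

/-- The capacity of the deletion channel. -/
noncomputable def capacity {d : ℝ} (hd0 : 0 ≤ d) (hd1 : d ≤ 1) : ℝ :=
  (subadditive_maxInfo hd0 hd1).lim

lemma tendsto_maxInfo_div {d : ℝ} (hd0 : 0 ≤ d) (hd1 : d ≤ 1) :
    Tendsto (fun n : ℕ => maxInfo d n / n) atTop (𝓝 (capacity hd0 hd1)) :=
  (subadditive_maxInfo hd0 hd1).tendsto_lim (bddBelow_maxInfo_div hd0 hd1)

lemma capacity_mul_le_maxInfo {d : ℝ} (hd0 : 0 ≤ d) (hd1 : d ≤ 1) (n : ℕ) :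
    n * capacity hd0 hd1 ≤ maxInfo d n := by
  rcases eq_or_ne n 0 with rfl | hn
  · simpa using maxInfo_nonneg hd0 hd1 0
  · have := (subadditive_maxInfo hd0 hd1).lim_le_div (bddBelow_maxInfo_div hd0 hd1) hn
    rw [le_div_iff₀ (by positivity), mul_comm] at this
    exact this

lemma HasInfoRate.le_capacity {d : ℝ} (hd0 : 0 ≤ d) (hd1 : d ≤ 1) {μ : Measure (ℤ → Bool)}
    [IsProbabilityMeasure μ] {r : ℝ} (h : HasInfoRate d μ r) : r ≤ capacity hd0 hd1 :=
  le_of_tendsto_of_tendsto' h (tendsto_maxInfo_div hd0 hd1) fun n =>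
    div_le_div_of_nonneg_right (blockInfo_le_maxInfo d (prefixLaw_mem_stdSimplex μ n))
      n.cast_nonneg

lemma HasInfoRate.mul_le {d : ℝ} (hd0 : 0 ≤ d) (hd1 : d ≤ 1) {μ : Measure (ℤ → Bool)}
    [IsProbabilityMeasure μ] (hμ : MeasurePreserving shift μ μ) {r : ℝ} (h : HasInfoRate d μ r)
    {n : ℕ} (hn : n ≠ 0) : n * r ≤ blockInfo d n (prefixLaw μ n) := by
  rw [tendsto_nhds_unique h (hasInfoRate_lim hd0 hd1 hμ)]
  have := (subadditive_blockInfo hd0 hd1 hμ).lim_le_div (bddBelow_blockInfo_div hd0 hd1 μ) hn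
  rw [le_div_iff₀ (by positivity), mul_comm] at this
  exact this

/-! ### Averaging over windows -/

/-- A subadditive function of blocks is bounded, up to boundary terms, by the average of its
values on all windows of length `k`. -/
lemma mul_le_sum_windows {f : ℕ → ℕ → ℝ} (hf0 : ∀ a l, 0 ≤ f a l)
    (hf : ∀ a l m, f a (l + m) ≤ f a l + f (a + l) m) {k : ℕ} (hk : 0 < k) {c : ℝ}
    (hc : ∀ a, ∀ s ≤ k, f a s ≤ c) (N : ℕ) :
    k * f 0 N ≤ 2 * k * c + ∑ j ∈ range N, f j k := by
  have hc0 : 0 ≤ c := (hf0 0 0).trans (hc 0 0 k.zero_le)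
  have hblocks : ∀ s ≤ k, ∀ q a, f a (q * k + s) ≤ c + ∑ i ∈ range q, f (a + i * k) k := by
    intro s hs q
    induction q with
    | zero => intro a; simpa using hc a s hs
    | succ q ih =>
      intro a
      rw [Finset.sum_range_succ', show (q + 1) * k + s = k + (q * k + s) by ring]
      have h1 := hf a k (q * k + s)
      have h2 := ih (a + k)
      simp only [zero_mul, add_zero, add_mul, one_mul]
      have h3 : ∀ i, a + k + i * k = a + (i * k + k) := fun i => by ring
      simp only [h3] at h2
      linarith
  -- Cut at the positions congruent to `r` modulo `k`: the initial and final pieces cost at most `c`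
  -- each. Over the `k` phases every window start below `N` occurs once, which gives the `2 * k *
  -- c`. Windows overrunning `N` only enlarge the bound.
  have hphase : ∀ r ∈ range k, f 0 N ≤ 2 * c + ∑ j ∈ range N with j % k = r, f j k := by
    intro r hr
    have hrk := Finset.mem_range.1 hr
    rcases lt_or_ge N r with hN | hN
    · have := hc 0 N (hN.le.trans hrk.le)
      have h2 : 0 ≤ ∑ j ∈ range N with j % k = r, f j k := Finset.sum_nonneg fun _ _ => hf0 _ _
      linarith
    · have h1 := hf 0 r (N - r)
      have h2 := hblocks ((N - r) % k) (Nat.mod_lt _ hk).le ((N - r) / k) r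
      have h3 := hc 0 r hrk.le
      rw [Nat.div_add_mod'] at h2
      rw [Nat.add_sub_cancel' hN, zero_add] at h1
      have h4 : ∑ i ∈ range ((N - r) / k), f (r + i * k) k
          ≤ ∑ j ∈ range N with j % k = r, f j k := by
        rw [← Finset.sum_image (f := fun j => f j k) (g := fun i => r + i * k)]
        · refine Finset.sum_le_sum_of_subset_of_nonneg ?_ fun _ _ _ => hf0 _ _
          intro j hj
          obtain ⟨i, hi, rfl⟩ := Finset.mem_image.1 hj
          have hi' : i + 1 ≤ (N - r) / k := Finset.mem_range.1 hi
          have := (Nat.mul_le_mul_right k hi').trans (Nat.div_mul_le_self (N - r) k)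
          rw [add_mul, one_mul] at this
          rw [Finset.mem_filter, Finset.mem_range, Nat.add_mul_mod_self_right,
            Nat.mod_eq_of_lt hrk]
          omega
        · intro i _ j _ hij
          exact Nat.eq_of_mul_eq_mul_right hk (Nat.add_left_cancel hij)
      linarith
  have hsum := Finset.sum_le_sum hphase
  rw [Finset.sum_add_distrib, Finset.sum_fiberwise_of_maps_to
    (fun j _ => Finset.mem_range.2 (Nat.mod_lt j hk))] at hsum
  simp only [Finset.sum_const, Finset.card_range, nsmul_eq_mul] at hsum
  linarith

end DeletionChannel

namespace DeletionChannel

open Finset Real MeasureTheory Filter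
open scoped Topology ENNReal BoundedContinuousFunction

/-! ### A stationary law attaining the capacity -/

/-- The sequence starting with the word `x` and constant elsewhere. -/
def extend {n : ℕ} (x : Fin n → Bool) (i : ℤ) : Bool :=
  if h : 0 < i ∧ i ≤ n then x ⟨(i - 1).toNat, by omega⟩ else false

lemma extend_mem_cylinder {n : ℕ} {x y : Fin n → Bool} : extend x ∈ cylinder y ↔ x = y := by
  have h : ∀ i : Fin n, extend x ((i : ℤ) + 1) = x i := fun i => by
    have := i.2
    rw [extend, dif_pos (by omega)]
    congr 1
    ext
    simp
  simp only [cylinder, Set.mem_ofPred_eq, h, funext_iff]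

/-- A finite mixture of Dirac masses suffices, since `extend x` lies in the cylinder of `x` and in
no other of that length. -/
lemma exists_prefixLaw_eq {n : ℕ} {p : (Fin n → Bool) → ℝ}
    (hp : p ∈ stdSimplex ℝ (Fin n → Bool)) :
    ∃ μ : Measure (ℤ → Bool), IsProbabilityMeasure μ ∧ prefixLaw μ n = p := by
  have hsum : ∑ x, ENNReal.ofReal (p x) = 1 := by
    rw [← ENNReal.ofReal_sum_of_nonneg fun x _ => hp.1 x, hp.2, ENNReal.ofReal_one]
  refine ⟨∑ x, ENNReal.ofReal (p x) • Measure.dirac (extend x), ⟨?_⟩, ?_⟩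
  · simpa using hsum
  · ext x
    rw [prefixLaw_eq, measureReal_def]
    simp only [Measure.coe_finsetSum, Finset.sum_apply, Measure.smul_apply, smul_eq_mul,
      Measure.dirac_apply' _ (measurableSet_cylinder x)]
    rw [Finset.sum_eq_single x]
    · rw [Set.indicator_of_mem (extend_mem_cylinder.2 rfl), Pi.one_apply, mul_one]
      exact ENNReal.toReal_ofReal (hp.1 x)
    · intro z _ hz
      rw [Set.indicator_of_notMem (mt extend_mem_cylinder.1 hz), mul_zero]
    · simp

/-- The average of the first `N` shifts of a measure. -/
noncomputable def shiftAverage (μ : Measure (ℤ → Bool)) (N : ℕ) : Measure (ℤ → Bool) :=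
  (N : ℝ≥0∞)⁻¹ • ∑ j ∈ range N, μ.map shift^[j]

lemma isProbabilityMeasure_map_shift (μ : Measure (ℤ → Bool)) [IsProbabilityMeasure μ] (j : ℕ) :
    IsProbabilityMeasure (μ.map shift^[j]) :=
  Measure.isProbabilityMeasure_map (measurable_shift.iterate j).aemeasurable

lemma isProbabilityMeasure_shiftAverage (μ : Measure (ℤ → Bool)) [IsProbabilityMeasure μ]
    {N : ℕ} (hN : N ≠ 0) : IsProbabilityMeasure (shiftAverage μ N) := by
  have := isProbabilityMeasure_map_shift μ
  constructor
  simp only [shiftAverage, Measure.smul_apply, Measure.coe_finsetSum, Finset.sum_apply,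
    measure_univ, Finset.sum_const, Finset.card_range, nsmul_eq_mul, mul_one, smul_eq_mul]
  exact ENNReal.inv_mul_cancel (by exact_mod_cast hN) (ENNReal.natCast_ne_top N)

lemma prefixLaw_shiftAverage (μ : Measure (ℤ → Bool)) [IsProbabilityMeasure μ] (N k : ℕ) :
    prefixLaw (shiftAverage μ N) k
      = ∑ j ∈ range N, (N : ℝ)⁻¹ • prefixLaw (μ.map shift^[j]) k := by
  have := isProbabilityMeasure_map_shift μ
  ext x
  simp only [prefixLaw_eq, shiftAverage, measureReal_ennreal_smul_apply, Finset.sum_apply,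
    Pi.smul_apply, smul_eq_mul, ← Finset.mul_sum, ENNReal.toReal_inv, ENNReal.toReal_natCast]
  rw [measureReal_def, Measure.coe_finsetSum, Finset.sum_apply,
    ENNReal.toReal_sum fun j _ => measure_ne_top _ _]
  rfl

lemma integral_shiftAverage (μ : Measure (ℤ → Bool)) [IsProbabilityMeasure μ] (N : ℕ)
    (g : (ℤ → Bool) →ᵇ ℝ) :
    ∫ ω, g ω ∂shiftAverage μ N = (N : ℝ)⁻¹ * ∑ j ∈ range N, ∫ ω, g (shift^[j] ω) ∂μ := by
  have := isProbabilityMeasure_map_shift μ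
  rw [shiftAverage, integral_smul_measure, integral_finsetSum_measure
    fun j _ => g.integrable _]
  simp only [ENNReal.toReal_inv, ENNReal.toReal_natCast, smul_eq_mul]
  congr 1
  refine Finset.sum_congr rfl fun j _ => ?_
  exact integral_map (measurable_shift.iterate j).aemeasurable
    g.continuous.aestronglyMeasurable

/-- The difference telescopes: only the terms for shifts `0` and `N` survive. -/
lemma abs_integral_shift_shiftAverage_sub_le (μ : Measure (ℤ → Bool)) [IsProbabilityMeasure μ]
    (N : ℕ) (g : (ℤ → Bool) →ᵇ ℝ) :
    |∫ ω, g (shift ω) ∂shiftAverage μ N - ∫ ω, g ω ∂shiftAverage μ N|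
      ≤ (N : ℝ)⁻¹ * (2 * ‖g‖) := by
  have h := integral_shiftAverage μ N (g.compContinuous ⟨shift, continuous_shift⟩)
  simp only [BoundedContinuousFunction.compContinuous_apply, ContinuousMap.coe_mk] at h
  rw [h, integral_shiftAverage μ N g, ← mul_sub, ← Finset.sum_sub_distrib, abs_mul,
    abs_of_nonneg (by positivity)]
  refine mul_le_mul_of_nonneg_left ?_ (by positivity)
  simp only [← Function.iterate_succ_apply' shift]
  rw [Finset.sum_range_sub (fun j => ∫ ω, g (shift^[j] ω) ∂μ)]
  have hb : ∀ j, |∫ ω, g (shift^[j] ω) ∂μ| ≤ ‖g‖ := fun j => by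
    have := norm_integral_le_of_norm_le_const (μ := μ)
      (Eventually.of_forall fun ω => g.norm_coe_le_norm (shift^[j] ω))
    simpa using this
  calc _ ≤ |∫ ω, g (shift^[N] ω) ∂μ| + |∫ ω, g (shift^[0] ω) ∂μ| := abs_sub _ _
    _ ≤ 2 * ‖g‖ := by linarith [hb N, hb 0]

/-- Averaging the shifts of a measure preserves the information per symbol, up to boundary
terms. -/
lemma le_blockInfo_shiftAverage {d : ℝ} (hd0 : 0 ≤ d) (hd1 : d ≤ 1) (μ : Measure (ℤ → Bool))
    [IsProbabilityMeasure μ] {N k : ℕ} (hN : N ≠ 0) (hk : 0 < k) :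
    k * (blockInfo d N (prefixLaw μ N) / N)
        - 2 * k * (∑ s ∈ range (k + 1), maxInfo d s) / N
      ≤ blockInfo d k (prefixLaw (shiftAverage μ N) k) := by
  have := isProbabilityMeasure_map_shift μ
  have hN' : (0 : ℝ) < N := by positivity
  -- Here `f a l` is the information of the `l` symbols following position `a`. The sum of all
  -- `maxInfo d s` with `s ≤ k` is a crude bound, uniform in `a`, for short blocks.
  have h1 := mul_le_sum_windows (f := fun a l => blockInfo d l (prefixLaw (μ.map shift^[a]) l))
    (fun a l => blockInfo_nonneg hd0 hd1 (prefixLaw_mem_stdSimplex _ _))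
    (fun a l m => by
      have := blockInfo_prefixLaw_add_le hd0 hd1 (μ.map shift^[a]) l m
      rwa [Measure.map_map (measurable_shift.iterate l) (measurable_shift.iterate a),
        ← Function.iterate_add, Nat.add_comm l a] at this) hk
    (c := ∑ s ∈ range (k + 1), maxInfo d s)
    (fun a s hs => (blockInfo_le_maxInfo d (prefixLaw_mem_stdSimplex _ _)).trans
      (Finset.single_le_sum (f := maxInfo d) (fun s _ => maxInfo_nonneg hd0 hd1 s)
        (Finset.mem_range.2 (Nat.lt_succ_of_le hs)))) N
  -- Concavity moves the average over shifts inside `blockInfo`.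
  have h2 := (concaveOn_blockInfo hd0 hd1 k).le_map_sum (t := range N) (w := fun _ => (N : ℝ)⁻¹)
    (p := fun j => prefixLaw (μ.map shift^[j]) k) (fun _ _ => by positivity)
    (by simp [hN'.ne']) (fun j _ => prefixLaw_mem_stdSimplex _ _)
  rw [← prefixLaw_shiftAverage] at h2
  simp only [smul_eq_mul, ← Finset.mul_sum] at h2
  refine le_trans ?_ h2
  simp only [Function.iterate_zero, Measure.map_id] at h1
  rw [mul_div_assoc', ← sub_div, div_eq_inv_mul]
  exact mul_le_mul_of_nonneg_left (by linarith) (by positivity)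

/-- Cylinders are clopen, so weak convergence implies convergence of their masses. -/
lemma continuous_prefixLaw (n : ℕ) :
    Continuous fun μ : ProbabilityMeasure (ℤ → Bool) => prefixLaw (μ : Measure (ℤ → Bool)) n := by
  refine continuous_pi fun x => continuous_iff_continuousAt.2 fun μ => ?_
  exact (NNReal.continuous_coe.tendsto _).comp
    (ProbabilityMeasure.tendsto_measure_of_isClopen_of_tendsto tendsto_id (isClopen_cylinder x))

/-- The stationary laws whose information rate is at least the capacity. -/
def optimalLaws {d : ℝ} (hd0 : 0 ≤ d) (hd1 : d ≤ 1) : Set (ProbabilityMeasure (ℤ → Bool)) :=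
  {μ | (μ.map continuous_shift.aemeasurable = μ) ∧
    ∀ k : ℕ, k ≠ 0 → k * capacity hd0 hd1 ≤ blockInfo d k (prefixLaw (μ : Measure (ℤ → Bool)) k)}

/-- A limit of continuous functions need not be continuous, but bounding every block from below is
an intersection of closed conditions, one for each block length. -/
lemma isCompact_optimalLaws {d : ℝ} (hd0 : 0 ≤ d) (hd1 : d ≤ 1) :
    IsCompact (optimalLaws hd0 hd1) := by
  refine IsClosed.isCompact (IsClosed.inter ?_ ?_)
  · exact isClosed_eq (ProbabilityMeasure.continuous_map continuous_shift) continuous_id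
  · have : {μ : ProbabilityMeasure (ℤ → Bool) | ∀ k : ℕ, k ≠ 0 →
        k * capacity hd0 hd1 ≤ blockInfo d k (prefixLaw (μ : Measure (ℤ → Bool)) k)}
        = ⋂ (k : ℕ) (_ : k ≠ 0), {μ : ProbabilityMeasure (ℤ → Bool) |
          k * capacity hd0 hd1 ≤ blockInfo d k (prefixLaw (μ : Measure (ℤ → Bool)) k)} := by
      ext; simp
    change IsClosed {μ : ProbabilityMeasure (ℤ → Bool) | ∀ k : ℕ, k ≠ 0 →
        k * capacity hd0 hd1 ≤ blockInfo d k (prefixLaw (μ : Measure (ℤ → Bool)) k)}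
    rw [this]
    exact isClosed_iInter fun k => isClosed_iInter fun _ =>
      isClosed_le continuous_const ((continuous_blockInfo d k).comp (continuous_prefixLaw k))

/-- A Krylov–Bogolyubov argument started from laws that maximise the information of the first `N`
symbols. -/
lemma optimalLaws_nonempty {d : ℝ} (hd0 : 0 ≤ d) (hd1 : d ≤ 1) :
    (optimalLaws hd0 hd1).Nonempty := by
  have hP : ∀ N : ℕ, ∃ μ : Measure (ℤ → Bool), IsProbabilityMeasure μ ∧
      blockInfo d N (prefixLaw μ N) = maxInfo d N := fun N => by
    obtain ⟨p, hp, h⟩ := (isGreatest_maxInfo d N).1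
    obtain ⟨μ, hμ, hμp⟩ := exists_prefixLaw_eq hp
    exact ⟨μ, hμ, by rw [hμp, h]⟩
  choose P hPprob hPinfo using hP
  let Q : ℕ → ProbabilityMeasure (ℤ → Bool) := fun N =>
    ⟨shiftAverage (P (N + 1)) (N + 1), isProbabilityMeasure_shiftAverage _ N.succ_ne_zero⟩
  -- Compactness is used through the limit along a free ultrafilter, in place of a convergent
  -- subsequence.
  obtain ⟨ν, -, hν⟩ := isCompact_univ.ultrafilter_le_nhds ((hyperfilter ℕ).map Q) (by simp)
  have hlim : Tendsto Q (hyperfilter ℕ) (𝓝 ν) := hν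
  have hat : (hyperfilter ℕ : Filter ℕ) ≤ atTop := Nat.hyperfilter_le_atTop
  have hinv : ∀ c : ℝ, Tendsto (fun N : ℕ => ((N + 1 : ℕ) : ℝ)⁻¹ * c) (hyperfilter ℕ) (𝓝 0) := by
    intro c
    have h1 : Tendsto (fun N : ℕ => ((N + 1 : ℕ) : ℝ)⁻¹) atTop (𝓝 0) :=
      (tendsto_inv_atTop_nhds_zero_nat (𝕜 := ℝ)).comp (tendsto_add_atTop_nat 1)
    simpa using (h1.mul_const c).mono_left hat
  refine ⟨ν, ?_, fun k hk => ?_⟩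
  · apply ProbabilityMeasure.toMeasure_injective
    rw [ProbabilityMeasure.toMeasure_map]
    have : IsProbabilityMeasure ((ν : Measure (ℤ → Bool)).map shift) :=
      Measure.isProbabilityMeasure_map measurable_shift.aemeasurable
    refine ext_of_forall_integral_eq_of_IsFiniteMeasure fun g => ?_
    rw [integral_map measurable_shift.aemeasurable g.continuous.aestronglyMeasurable]
    have hg := ProbabilityMeasure.tendsto_iff_forall_integral_tendsto.1 hlim
    have h1 := hg g
    have h2 := hg (g.compContinuous ⟨shift, continuous_shift⟩)
    simp only [BoundedContinuousFunction.compContinuous_apply, ContinuousMap.coe_mk] at h2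
    have h3 := h2.sub h1
    have h4 : Tendsto (fun N => ∫ ω, g (shift ω) ∂(Q N : Measure (ℤ → Bool))
        - ∫ ω, g ω ∂(Q N : Measure (ℤ → Bool))) (hyperfilter ℕ) (𝓝 0) :=
      squeeze_zero_norm (fun N => abs_integral_shift_shiftAverage_sub_le (P (N + 1)) (N + 1) g)
        (hinv _)
    exact sub_eq_zero.1 (tendsto_nhds_unique h3 h4)
  · have h1 : Tendsto (fun N => blockInfo d k (prefixLaw (Q N : Measure (ℤ → Bool)) k))
        (hyperfilter ℕ) (𝓝 (blockInfo d k (prefixLaw (ν : Measure (ℤ → Bool)) k))) :=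
      (((continuous_blockInfo d k).comp (continuous_prefixLaw k)).tendsto ν).comp hlim
    have h2 : Tendsto (fun N : ℕ => k * capacity hd0 hd1 - ((N + 1 : ℕ) : ℝ)⁻¹ *
        (2 * k * (∑ s ∈ range (k + 1), maxInfo d s))) (hyperfilter ℕ)
        (𝓝 (k * capacity hd0 hd1 - 0)) := tendsto_const_nhds.sub (hinv _)
    rw [sub_zero] at h2
    refine le_of_tendsto_of_tendsto' h2 h1 fun N => ?_
    refine le_trans ?_ (le_blockInfo_shiftAverage hd0 hd1 (P (N + 1)) N.succ_ne_zero
      (Nat.pos_of_ne_zero hk))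
    rw [← div_eq_inv_mul]
    refine sub_le_sub_right (mul_le_mul_of_nonneg_left ?_ k.cast_nonneg) _
    rw [hPinfo, le_div_iff₀ (by positivity), mul_comm]
    exact capacity_mul_le_maxInfo hd0 hd1 (N + 1)

/-- The rate of a stationary law is the infimum of its block quotients and never exceeds the
capacity, so the lower bound on all blocks forces equality. -/
lemma mem_optimalLaws_iff {d : ℝ} (hd0 : 0 ≤ d) (hd1 : d ≤ 1)
    {μ : ProbabilityMeasure (ℤ → Bool)} :
    μ ∈ optimalLaws hd0 hd1 ↔ MeasurePreserving shift (μ : Measure (ℤ → Bool)) μ ∧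
      HasInfoRate d μ (capacity hd0 hd1) := by
  constructor
  · rintro ⟨h1, h2⟩
    have hμ : MeasurePreserving shift (μ : Measure (ℤ → Bool)) μ := by
      refine ⟨measurable_shift, ?_⟩
      rw [← ProbabilityMeasure.toMeasure_map μ continuous_shift.aemeasurable, h1]
    refine ⟨hμ, ?_⟩
    have h := hasInfoRate_lim hd0 hd1 hμ
    have hle := h.le_capacity hd0 hd1
    have hge : capacity hd0 hd1 ≤ (subadditive_blockInfo hd0 hd1 hμ).lim := by
      refine ge_of_tendsto h ((eventually_ne_atTop 0).mono fun k hk => ?_)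
      rw [le_div_iff₀ (by positivity), mul_comm]
      exact h2 k hk
    rwa [le_antisymm hle hge] at h
  · rintro ⟨hμ, h⟩
    refine ⟨ProbabilityMeasure.toMeasure_injective ?_, fun k hk => h.mul_le hd0 hd1 hμ hk⟩
    rw [ProbabilityMeasure.toMeasure_map, hμ.map_eq]

/-! ### Mixtures, extreme points and ergodicity -/

lemma prefixLaw_mix (μ ν : Measure (ℤ → Bool)) [IsFiniteMeasure μ] [IsFiniteMeasure ν]
    {a b : ℝ≥0∞} (ha : a ≠ ∞) (hb : b ≠ ∞) (n : ℕ) :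
    prefixLaw (a • μ + b • ν) n = a.toReal • prefixLaw μ n + b.toReal • prefixLaw ν n := by
  have := Measure.smul_finite μ ha
  have := Measure.smul_finite ν hb
  ext x
  simp only [prefixLaw_eq, Pi.add_apply, Pi.smul_apply, smul_eq_mul]
  rw [measureReal_add_apply, measureReal_ennreal_smul_apply, measureReal_ennreal_smul_apply]

/-- The entropy of the weights does not depend on `n`, so it disappears after division by `n`. -/
lemma HasInfoRate.mix_le {d : ℝ} (hd0 : 0 ≤ d) (hd1 : d ≤ 1) {μ ν : Measure (ℤ → Bool)}
    [IsProbabilityMeasure μ] [IsProbabilityMeasure ν] {a b : ℝ≥0∞} (ha : a ≠ ∞) (hb : b ≠ ∞)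
    {r s t : ℝ} (hr : HasInfoRate d μ r) (hs : HasInfoRate d ν s)
    (ht : HasInfoRate d (a • μ + b • ν) t) : t ≤ a.toReal * r + b.toReal * s := by
  have h0 : Tendsto (fun n : ℕ =>
      (negMulLog a.toReal + negMulLog b.toReal) / Real.log 2 / (n : ℝ)) atTop (𝓝 0) :=
    tendsto_const_div_atTop_nhds_zero_nat _
  have h := ((hr.const_mul a.toReal).add (hs.const_mul b.toReal)).add h0
  rw [add_zero] at h
  refine le_of_tendsto_of_tendsto' ht h fun n => ?_
  rw [mul_div_assoc', mul_div_assoc', ← add_div, ← add_div, prefixLaw_mix μ ν ha hb]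
  exact div_le_div_of_nonneg_right (blockInfo_mix_le hd0 hd1 (prefixLaw_mem_stdSimplex μ n)
    (prefixLaw_mem_stdSimplex ν n) ENNReal.toReal_nonneg ENNReal.toReal_nonneg) n.cast_nonneg

/-- If a mixture of stationary laws attains the capacity, so do its components. -/
lemma mem_optimalLaws_of_mix {d : ℝ} (hd0 : 0 ≤ d) (hd1 : d ≤ 1)
    {μ ν₁ ν₂ : ProbabilityMeasure (ℤ → Bool)} (hμ : μ ∈ optimalLaws hd0 hd1)
    (h₁ : MeasurePreserving shift (ν₁ : Measure (ℤ → Bool)) ν₁)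
    (h₂ : MeasurePreserving shift (ν₂ : Measure (ℤ → Bool)) ν₂)
    {a b : ℝ≥0∞} (ha : 0 < a) (hab : a + b = 1)
    (h : a • (ν₁ : Measure (ℤ → Bool)) + b • (ν₂ : Measure (ℤ → Bool)) = μ) :
    ν₁ ∈ optimalLaws hd0 hd1 := by
  have ha' : a ≠ ∞ := fun h0 => by simp [h0] at hab
  have hb' : b ≠ ∞ := fun h0 => by simp [h0] at hab
  have hab' : a.toReal + b.toReal = 1 := by rw [← ENNReal.toReal_add ha' hb', hab]; rfl
  have hapos : 0 < a.toReal := ENNReal.toReal_pos ha.ne' ha'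
  have hr₁ := hasInfoRate_lim hd0 hd1 h₁
  have hr₂ := hasInfoRate_lim hd0 hd1 h₂
  have hrμ := ((mem_optimalLaws_iff hd0 hd1).1 hμ).2
  rw [← h] at hrμ
  have hmix := HasInfoRate.mix_le hd0 hd1 ha' hb' hr₁ hr₂ hrμ
  have hle₁ := hr₁.le_capacity hd0 hd1
  have hle₂ := hr₂.le_capacity hd0 hd1
  refine (mem_optimalLaws_iff hd0 hd1).2 ⟨h₁, ?_⟩
  suffices heq : (subadditive_blockInfo hd0 hd1 h₁).lim = capacity hd0 hd1 by rwa [heq] at hr₁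
  refine le_antisymm hle₁ (le_of_mul_le_mul_left ?_ hapos)
  have h3 := mul_le_mul_of_nonneg_left hle₂ (ENNReal.toReal_nonneg (a := b))
  have h4 : capacity hd0 hd1
      = a.toReal * capacity hd0 hd1 + b.toReal * capacity hd0 hd1 := by
    rw [← add_mul, hab', one_mul]
  linarith

/-- Integration of bounded continuous functions, as a map to a product of lines. -/
noncomputable def integralMap (μ : ProbabilityMeasure (ℤ → Bool)) (g : (ℤ → Bool) →ᵇ ℝ) : ℝ :=
  ∫ ω, g ω ∂(μ : Measure (ℤ → Bool))

lemma continuous_integralMap : Continuous integralMap :=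
  continuous_pi fun g => continuous_iff_continuousAt.2 fun _ =>
    ProbabilityMeasure.tendsto_iff_forall_integral_tendsto.1 tendsto_id g

lemma integralMap_injective : Function.Injective integralMap := fun _ _ h =>
  ProbabilityMeasure.toMeasure_injective (ext_of_forall_integral_eq_of_IsFiniteMeasure fun g => congrFun h g)

lemma exists_ergodic_mem_optimalLaws {d : ℝ} (hd0 : 0 ≤ d) (hd1 : d ≤ 1) :
    ∃ μ ∈ optimalLaws hd0 hd1, Ergodic shift (μ : Measure (ℤ → Bool)) := by
  -- Existence of extreme points needs an ambient vector space, so the compact set of optimal laws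
  -- is embedded by `integralMap`, which respects mixtures.
  obtain ⟨_, ⟨μ, hμ, rfl⟩, hext⟩ := ((isCompact_optimalLaws hd0 hd1).image
    continuous_integralMap).extremePoints_nonempty ((optimalLaws_nonempty hd0 hd1).image _)
  refine ⟨μ, hμ, Ergodic.of_mem_extremePoints
    ⟨⟨((mem_optimalLaws_iff hd0 hd1).1 hμ).1, inferInstance⟩, ?_⟩⟩
  -- Ergodicity requires extremality among all invariant probability measures. The face property
  -- places both components among the optimal laws, where extremality of the image applies.
  rintro ν₁ ⟨hs₁, hp₁⟩ ν₂ ⟨hs₂, hp₂⟩ ⟨a, b, ha, hb, hab, h⟩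
  have ha' : a ≠ ∞ := fun h0 => by simp [h0] at hab
  have hb' : b ≠ ∞ := fun h0 => by simp [h0] at hab
  have h₁ : (⟨ν₁, hp₁⟩ : ProbabilityMeasure (ℤ → Bool)) ∈ optimalLaws hd0 hd1 :=
    mem_optimalLaws_of_mix hd0 hd1 (ν₂ := ⟨ν₂, hp₂⟩) hμ hs₁ hs₂ ha hab h
  have h₂ : (⟨ν₂, hp₂⟩ : ProbabilityMeasure (ℤ → Bool)) ∈ optimalLaws hd0 hd1 :=
    mem_optimalLaws_of_mix hd0 hd1 (ν₂ := ⟨ν₁, hp₁⟩) hμ hs₂ hs₁ hb ((add_comm b a).trans hab)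
      ((add_comm _ _).trans h)
  have hseg : integralMap μ ∈ openSegment ℝ (integralMap ⟨ν₁, hp₁⟩) (integralMap ⟨ν₂, hp₂⟩) := by
    refine ⟨a.toReal, b.toReal, ENNReal.toReal_pos ha.ne' ha', ENNReal.toReal_pos hb.ne' hb', ?_, ?_⟩
    · rw [← ENNReal.toReal_add ha' hb', hab]; rfl
    · ext g
      simp only [integralMap, ← h, Pi.add_apply, Pi.smul_apply, ProbabilityMeasure.coe_mk]
      rw [integral_add_measure ((g.integrable ν₁).smul_measure ha')
        ((g.integrable ν₂).smul_measure hb'), integral_smul_measure, integral_smul_measure]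
  exact congrArg Subtype.val
    (integralMap_injective (hext ⟨_, h₁, rfl⟩ ⟨_, h₂, rfl⟩ hseg))

end DeletionChannel

theorem lemma2 (d : ℝ) (hd0 : 0 ≤ d) (hd1 : d ≤ 1) :
    -- `I(𝕏)` exists for every stationary ergodic process
    (∀ μ : MeasureTheory.Measure (ℤ → Bool), DeletionChannel.IsStationaryErgodic μ →
      ∃ r : ℝ, DeletionChannel.HasInfoRate d μ r) ∧
    -- the supremum defining `C_n` is a maximum
    (∀ n : ℕ, 1 ≤ n →
      IsGreatest ((fun p => DeletionChannel.blockInfo d n p / n) '' stdSimplex ℝ (Fin n → Bool))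
        (DeletionChannel.blockCapacity d n)) ∧
    -- `C = lim C_n` exists and is the maximum of `I(𝕏)` over stationary ergodic processes
    (∃ C : ℝ,
      Filter.Tendsto (fun n : ℕ => DeletionChannel.blockCapacity d n) Filter.atTop (nhds C) ∧
      IsGreatest {r : ℝ | ∃ μ : MeasureTheory.Measure (ℤ → Bool),
        DeletionChannel.IsStationaryErgodic μ ∧ DeletionChannel.HasInfoRate d μ r} C) := by
  refine ⟨?_, fun n _ => ?_, DeletionChannel.capacity hd0 hd1, ?_, ?_, ?_⟩
  · rintro μ ⟨hprob, herg⟩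
    exact ⟨_, DeletionChannel.hasInfoRate_lim hd0 hd1 herg.toMeasurePreserving⟩
  · rw [DeletionChannel.blockCapacity_eq]
    exact DeletionChannel.isGreatest_maxInfo_div d n
  · simp_rw [DeletionChannel.blockCapacity_eq]
    exact DeletionChannel.tendsto_maxInfo_div hd0 hd1
  · obtain ⟨μ, hμ, herg⟩ := DeletionChannel.exists_ergodic_mem_optimalLaws hd0 hd1
    exact ⟨μ, ⟨inferInstance, herg⟩, ((DeletionChannel.mem_optimalLaws_iff hd0 hd1).1 hμ).2⟩
  · rintro r ⟨μ, ⟨hprob, -⟩, hr⟩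
    exact hr.le_capacity hd0 hd1
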